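/- Let $F$ be an infinite field with $\operatorname{char} F \neq 2$, let $n \geq 3$ and $1 \leq k \leq n-1$. For $A \in M_n(F)$ let the permanental rank $\operatorname{prk}(A)$ be the largest $r \geq 0$ such that $A$ has an $r \times r$ submatrix with nonzero permanent (the empty submatrix having permanent $1$), and let $\Lambda^k = \{A \in M_n(F) : \operatorname{prk}(A) = k\}$. For $\sigma \in S_n$ let $P(\sigma) \in M_n(F)$ be the permutation matrix whose $(i,j)$ entry is $1$ if $j = \sigma^{-1}(i)$ and $0$ otherwise. Let $T : M_n(F) \to M_n(F)$ be a bijective $F$-linear map. Then $T(\Lambda^k) \subseteq \Lambda^k$ if and only if there exist permutations $\sigma_1, \sigma_2 \in S_n$ and diagonal matrices $D_1, D_2 \in M_n(F)$ with nonzero diagonal entries such that either $$T(A) = D_1 P(\sigma_1)\, A\, P(\sigma_2) D_2 \quad \text{for all } A \in M_n(F),$$ or $$T(A) = D_1 P(\sigma_1)\, A^{T} P(\sigma_2) D_2 \quad \text{for all } A \in M_n(F).$$ -/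

import Mathlib

/-- The permanental rank of a square matrix: the largest `r` such that some `r × r` submatrix
(rows and columns chosen by increasing maps `Fin r → Fin n`) has nonzero permanent.
The empty submatrix has permanent `1`, so the set is nonempty, and it is bounded by `n`. -/
noncomputable def permanentalRank {F : Type*} [Field F] {n : ℕ}
    (A : Matrix (Fin n) (Fin n) F) : ℕ :=
  sSup {r : ℕ | ∃ f g : Fin r ↪o Fin n, (A.submatrix f g).permanent ≠ 0}

/-- The supremum in the definition of the permanental rank is a maximum. -/
theorem isGreatest_permanentalRank {F : Type*} [Field F] {n : ℕ}
    (A : Matrix (Fin n) (Fin n) F) :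
    IsGreatest {r : ℕ | ∃ f g : Fin r ↪o Fin n, (A.submatrix f g).permanent ≠ 0}
      (permanentalRank A) := by
  have hbdd : BddAbove
      {r : ℕ | ∃ f g : Fin r ↪o Fin n, (A.submatrix f g).permanent ≠ 0} := by
    refine ⟨n, ?_⟩
    rintro r ⟨f, -, -⟩
    simpa using Fintype.card_le_of_injective f f.injective
  have hne : Set.Nonempty
      {r : ℕ | ∃ f g : Fin r ↪o Fin n, (A.submatrix f g).permanent ≠ 0} :=
    ⟨0, Fin.castLEOrderEmb (Nat.zero_le n), Fin.castLEOrderEmb (Nat.zero_le n), by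
      rw [Matrix.permanent_isEmpty]; exact one_ne_zero⟩
  exact ⟨Nat.sSup_mem hne hbdd, fun r hr => le_csSup hbdd hr⟩

/-- The set of `n × n` matrices over `F` of permanental rank exactly `k`. -/
def permanentalRankSet (F : Type*) [Field F] (n k : ℕ) : Set (Matrix (Fin n) (Fin n) F) :=
  {A | permanentalRank A = k}

/-- The permutation matrix of `σ`, with entry `1` at `(i, j)` if `j = σ⁻¹ i`, and `0` otherwise. -/
def permutationMatrix (F : Type*) [Field F] {n : ℕ} (σ : Equiv.Perm (Fin n)) :
    Matrix (Fin n) (Fin n) F :=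
  Matrix.of fun i j => if j = σ⁻¹ i then 1 else 0

/-! The converse holds because permuting and rescaling lines multiplies each subpermanent by a
nonzero scalar and relocates it, and transposition preserves permanents.

For the direct implication, let `W` be the space of matrices supported on `k` fixed rows, or on `k`
fixed columns. Its members have permanental rank at most `k`, and some attain `k`. As `F` is
infinite, the vanishing of all subpermanents of size `k + 1` extends from the images of the rank-`k`
members to all of `T(W)` (`subpermanentsVanish_map`). The core is `exists_eq_supportedOn`: a space
of dimension `n * k` with this vanishing property is again the space of all matrices on `k` rows or
on `k` columns. Its proof studies the leading positions of members of the space. A transversal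
contains at most `k` of them, which together with the dimension forces them to fill `k` lines; a
dual basis at these positions then turns out to consist of matrix units.

So `T` carries line spaces to line spaces. Comparing those through a given cell shows that `T` sends
each matrix unit to a multiple of a matrix unit (`exists_map_single_eq`). The induced map of cells
respects collinearity (`sharesLine_map`), hence permutes rows and columns, up to transposition.
Finally, test matrices with a 2 × 2 block of zero permanent show that the scalars have vanishing 2 ×
2 minors (`mul_eq_mul_of_preserves_permanentalRank`), so they factor into the two diagonal matrices.
-/

/-! ### Permanents of sparse, scaled and reindexed matrices -/

section PermanentBasics

open Finset Matrix

/-- Reindexing rows and columns along two equivalences does not change the permanent. -/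
theorem permanent_submatrix_equivs {ι κ R : Type*} [Fintype ι] [DecidableEq ι] [Fintype κ]
    [DecidableEq κ] [CommSemiring R] (e₁ e₂ : ι ≃ κ) (A : Matrix κ κ R) :
    (A.submatrix e₁ e₂).permanent = A.permanent := by
  unfold Matrix.permanent
  refine Fintype.sum_equiv (Equiv.equivCongr e₂ e₁) _ _ fun σ => ?_
  refine Fintype.prod_equiv e₂ _ _ fun i => ?_
  simp [Equiv.equivCongr]

/-- A permutation fixing every point but `p` also fixes `p`, so only the identity term survives. -/
theorem permanent_eq_prod_of_row {ι R : Type*} [Fintype ι] [DecidableEq ι] [CommSemiring R]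
    {M : Matrix ι ι R} (p : ι) (h : ∀ r, r ≠ p → ∀ j, j ≠ r → M r j = 0) :
    M.permanent = ∏ i, M i i := by
  rw [← permanent_transpose]
  unfold Matrix.permanent
  refine (sum_eq_single 1 (fun σ _ hσ => ?_) (by simp)).trans (by simp)
  by_cases H : ∀ r, r ≠ p → σ r = r
  · refine absurd (Equiv.ext fun x => ?_) hσ
    by_cases hx : x = p
    · subst hx
      by_contra hne
      exact hne (σ.injective (H _ hne))
    · exact H x hx
  · push Not at H
    obtain ⟨r, hr, hr'⟩ := H
    exact prod_eq_zero (mem_univ r) (h r hr _ hr')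

/-- The permanent of a matrix that is diagonal outside two rows `p` and `q`. -/
theorem permanent_eq_of_two_rows {ι R : Type*} [Fintype ι] [DecidableEq ι] [CommSemiring R]
    {M : Matrix ι ι R} {p q : ι} (hpq : p ≠ q)
    (h : ∀ r, r ≠ p → r ≠ q → ∀ j, j ≠ r → M r j = 0) :
    M.permanent =
      (M p p * M q q + M p q * M q p) * ∏ i ∈ (univ.erase p).erase q, M i i := by
  rw [← permanent_transpose]
  unfold Matrix.permanent
  have hswap : (1 : Equiv.Perm ι) ≠ Equiv.swap p q := fun H => hpq (by
    have := congrArg (fun σ : Equiv.Perm ι => σ p) H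
    simpa using this)
  have hsub : ∑ σ ∈ {1, Equiv.swap p q}, ∏ i, Mᵀ (σ i) i
      = ∑ σ : Equiv.Perm ι, ∏ i, Mᵀ (σ i) i := by
    refine sum_subset (subset_univ _) fun σ _ hσ => ?_
    by_cases H : ∀ r, r ≠ p → r ≠ q → σ r = r
    · refine absurd ?_ hσ
      have hp : σ p = p ∨ σ p = q := by
        by_contra! hne
        exact hne.1 (σ.injective (H _ hne.1 hne.2))
      have hq : σ q = p ∨ σ q = q := by
        by_contra! hne
        exact hne.2 (σ.injective (H _ hne.1 hne.2))
      have hinj := σ.injective.ne hpq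
      rw [mem_insert, mem_singleton]
      rcases hp with hp | hp
      · have hq' : σ q = q := by
          rcases hq with hq | hq
          · exact absurd (hp.trans hq.symm) hinj
          · exact hq
        left
        ext1 x
        by_cases hx : x = p
        · subst hx; simpa using hp
        by_cases hx' : x = q
        · subst hx'; simpa using hq'
        simpa using H x hx hx'
      · have hq' : σ q = p := by
          rcases hq with hq | hq
          · exact hq
          · exact absurd (hp.trans hq.symm) hinj
        right
        ext1 x
        by_cases hx : x = p
        · subst hx; simpa using hp
        by_cases hx' : x = q
        · subst hx'; simpa using hq'
        rw [Equiv.swap_apply_of_ne_of_ne hx hx']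
        exact H x hx hx'
    · push Not at H
      obtain ⟨r, hr, hr', hr''⟩ := H
      exact prod_eq_zero (mem_univ r) (h r hr hr' _ hr'')
  have hq : q ∈ univ.erase p := by simp [hpq.symm]
  rw [← hsub, sum_pair hswap, ← mul_prod_erase _ _ (mem_univ p), ← mul_prod_erase _ _ hq,
    ← mul_prod_erase univ (fun i => Mᵀ (Equiv.swap p q i) i) (mem_univ p),
    ← mul_prod_erase _ (fun i => Mᵀ (Equiv.swap p q i) i) hq, add_mul]
  have hrest : ∏ i ∈ (univ.erase p).erase q, Mᵀ (Equiv.swap p q i) i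
      = ∏ i ∈ (univ.erase p).erase q, M i i := by
    refine prod_congr rfl fun i hi => ?_
    simp only [mem_erase] at hi
    rw [Equiv.swap_apply_of_ne_of_ne hi.2.1 hi.1, transpose_apply]
  rw [hrest]
  simp [mul_assoc]

/-- The sum of `g` is invariant under a permutation, so a nonidentity permutation lowers `g`
somewhere and its term contains a zero factor. -/
theorem permanent_eq_prod_of_monotone_support {ι R : Type*} [Fintype ι] [DecidableEq ι]
    [CommSemiring R] {n : ℕ} {g : ι → Fin n} (hg : Function.Injective g) {M : Matrix ι ι R}
    (h : ∀ a b, g b < g a → M a b = 0) : M.permanent = ∏ i, M i i := by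
  rw [← permanent_transpose]
  unfold Matrix.permanent
  refine (sum_eq_single 1 (fun σ _ hσ => ?_) (by simp)).trans (by simp)
  by_cases H : ∀ r, (g r : ℕ) ≤ g (σ r)
  · refine absurd (Equiv.ext fun x => ?_) hσ
    have hsum : ∑ r, (g r : ℕ) = ∑ r, (g (σ r) : ℕ) :=
      (Equiv.sum_comp σ fun r => (g r : ℕ)).symm
    have := (sum_eq_sum_iff_of_le fun r _ => H r).1 hsum x (mem_univ x)
    exact (hg (Fin.ext this)).symm
  · push Not at H
    obtain ⟨r, hr⟩ := H
    exact prod_eq_zero (mem_univ r) (h r _ (Fin.lt_def.2 hr))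

theorem permanent_scale {ι R : Type*} [Fintype ι] [DecidableEq ι] [CommSemiring R]
    (c d : ι → R) (M : Matrix ι ι R) :
    (Matrix.of fun i j => c i * M i j * d j).permanent = (∏ i, c i) * M.permanent * ∏ i, d i := by
  unfold Matrix.permanent
  rw [mul_sum, sum_mul]
  refine sum_congr rfl fun σ _ => ?_
  simp only [of_apply, prod_mul_distrib, Equiv.prod_comp σ c]

theorem exists_equiv_of_range_eq {ι κ α : Type*} {f : ι → α} {g : κ → α}
    (hf : Function.Injective f) (hg : Function.Injective g) (h : Set.range f = Set.range g) :
    ∃ e : ι ≃ κ, f = g ∘ e := by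
  refine ⟨(Equiv.ofInjective f hf).trans ((Equiv.setCongr h).trans (Equiv.ofInjective g hg).symm),
    funext fun i => ?_⟩
  simp [Equiv.apply_ofInjective_symm]

theorem permanent_submatrix_eq_of_range_eq {ι κ m R : Type*} [Fintype ι] [DecidableEq ι]
    [Fintype κ] [DecidableEq κ] [CommSemiring R] (A : Matrix m m R) {f g : ι → m} {f' g' : κ → m}
    (hf : Function.Injective f) (hg : Function.Injective g)
    (hf' : Function.Injective f') (hg' : Function.Injective g')
    (h₁ : Set.range f = Set.range f') (h₂ : Set.range g = Set.range g') :
    (A.submatrix f g).permanent = (A.submatrix f' g').permanent := by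
  obtain ⟨e₁, rfl⟩ := exists_equiv_of_range_eq hf hf' h₁
  obtain ⟨e₂, rfl⟩ := exists_equiv_of_range_eq hg hg' h₂
  rw [← permanent_submatrix_equivs e₁ e₂, submatrix_submatrix]

end PermanentBasics

/-! ### Bounds for the permanental rank -/

section PermanentalRank

open Finset Matrix

variable {F : Type*} [Field F] {n : ℕ}

/-- Permanents ignore the order of rows and columns, so arbitrary injective indexings may replace
the increasing ones of the definition. -/
theorem le_permanentalRank {ι : Type*} [Fintype ι] [DecidableEq ι]
    {A : Matrix (Fin n) (Fin n) F} {f g : ι → Fin n} (hf : Function.Injective f)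
    (hg : Function.Injective g) (h : (A.submatrix f g).permanent ≠ 0) :
    Fintype.card ι ≤ permanentalRank A := by
  have hcf : (univ.image f).card = Fintype.card ι := card_image_of_injective _ hf
  have hcg : (univ.image g).card = Fintype.card ι := card_image_of_injective _ hg
  refine (isGreatest_permanentalRank A).2
    ⟨(univ.image f).orderEmbOfFin hcf, (univ.image g).orderEmbOfFin hcg, ?_⟩
  rwa [permanent_submatrix_eq_of_range_eq A (RelEmbedding.injective _)
    (RelEmbedding.injective _) hf hg (by simp) (by simp)]

theorem permanentalRank_le {A : Matrix (Fin n) (Fin n) F} {k : ℕ}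
    (h : ∀ r (f g : Fin r ↪o Fin n), (A.submatrix f g).permanent ≠ 0 → r ≤ k) :
    permanentalRank A ≤ k := by
  obtain ⟨f, g, hfg⟩ := (isGreatest_permanentalRank A).1
  exact h _ f g hfg

/-- A matrix with nonzero permanent has a transversal of nonzero entries. -/
theorem exists_ne_zero_of_permanent_ne_zero {ι R : Type*} [Fintype ι] [DecidableEq ι]
    [CommSemiring R] {M : Matrix ι ι R} (h : M.permanent ≠ 0) :
    ∃ σ : Equiv.Perm ι, ∀ i, M (σ i) i ≠ 0 := by
  obtain ⟨σ, -, hσ⟩ := exists_ne_zero_of_sum_ne_zero h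
  exact ⟨σ, fun i hi => hσ (prod_eq_zero (mem_univ i) hi)⟩

theorem mem_of_permanent_ne_zero {ι : Type*} [Fintype ι] [DecidableEq ι]
    {A : Matrix (Fin n) (Fin n) F} {f g : ι → Fin n} (h : (A.submatrix f g).permanent ≠ 0)
    {R : Finset (Fin n)} (hA : ∀ i, i ∉ R → ∀ j, A i j = 0) (a : ι) : f a ∈ R := by
  obtain ⟨σ, hσ⟩ := exists_ne_zero_of_permanent_ne_zero h
  by_contra hne
  obtain ⟨b, rfl⟩ := σ.surjective a
  exact hσ b (hA _ hne _)

theorem mem_of_permanent_ne_zero' {ι : Type*} [Fintype ι] [DecidableEq ι]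
    {A : Matrix (Fin n) (Fin n) F} {f g : ι → Fin n} (h : (A.submatrix f g).permanent ≠ 0)
    {C : Finset (Fin n)} (hA : ∀ j, j ∉ C → ∀ i, A i j = 0) (a : ι) : g a ∈ C := by
  obtain ⟨σ, hσ⟩ := exists_ne_zero_of_permanent_ne_zero h
  by_contra hne
  exact hσ a (hA _ hne _)

theorem permanentalRank_le_card {A : Matrix (Fin n) (Fin n) F} {R : Finset (Fin n)}
    (hA : ∀ i, i ∉ R → ∀ j, A i j = 0) : permanentalRank A ≤ R.card :=
  permanentalRank_le fun r f g h => by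
    simpa using Fintype.card_le_of_injective
      (fun a => (⟨f a, mem_of_permanent_ne_zero h hA a⟩ : R))
      (fun a b hab => f.injective (congrArg Subtype.val hab))

/-- A lower bound for the permanental rank of a matrix that restricts to an invertible diagonal
matrix on the rows in `R`, along a permutation. -/
theorem card_le_permanentalRank_of_diagonal {A : Matrix (Fin n) (Fin n) F} {R : Finset (Fin n)}
    (σ : Equiv.Perm (Fin n)) (h₁ : ∀ r ∈ R, A r (σ r) ≠ 0)
    (h₂ : ∀ r ∈ R, ∀ s ∈ R, s ≠ r → A r (σ s) = 0) : R.card ≤ permanentalRank A := by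
  have := le_permanentalRank (A := A) (f := fun r : R => (r : Fin n))
    (g := fun r : R => σ r) Subtype.val_injective (σ.injective.comp Subtype.val_injective) ?_
  · simpa using this
  · have hd : A.submatrix (fun r : R => (r : Fin n)) (fun r : R => σ r)
        = diagonal fun r : R => A r (σ r) := by
      ext r s
      by_cases hrs : r = s
      · subst hrs; simp
      · rw [diagonal_apply_ne _ hrs]
        exact h₂ r r.2 s s.2 fun h => hrs (Subtype.ext h.symm)
    rw [hd, permanent_diagonal]
    exact prod_ne_zero_iff.2 fun r _ => h₁ r r.2

theorem permanentalRank_transpose (A : Matrix (Fin n) (Fin n) F) :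
    permanentalRank Aᵀ = permanentalRank A := by
  have key : ∀ A : Matrix (Fin n) (Fin n) F, permanentalRank Aᵀ ≤ permanentalRank A := fun A =>
    permanentalRank_le fun r f g h => by
      have := le_permanentalRank (A := A) (f := g) (g := f) g.injective f.injective (by
        rwa [← permanent_transpose, transpose_submatrix])
      simpa using this
  exact le_antisymm (key A) (by simpa using key Aᵀ)

/-- All subpermanents of size `k` of the matrix `A` are zero. -/
def SubpermanentsVanish (k : ℕ) (A : Matrix (Fin n) (Fin n) F) : Prop :=
  ∀ f g : Fin k → Fin n, Function.Injective f → Function.Injective g →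
    (A.submatrix f g).permanent = 0

theorem SubpermanentsVanish.permanent_submatrix_eq_zero {ι : Type*} [Fintype ι] [DecidableEq ι]
    {k : ℕ} {A : Matrix (Fin n) (Fin n) F} (hA : SubpermanentsVanish k A)
    (hι : Fintype.card ι = k) {f g : ι → Fin n} (hf : Function.Injective f)
    (hg : Function.Injective g) : (A.submatrix f g).permanent = 0 := by
  have e : Fin k ≃ ι := (Fintype.equivFinOfCardEq hι).symm
  rw [← hA (f ∘ e) (g ∘ e) (hf.comp e.injective) (hg.comp e.injective),
    ← permanent_submatrix_equivs e e, submatrix_submatrix]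

theorem SubpermanentsVanish.permanent_eq_zero {k : ℕ} {A : Matrix (Fin n) (Fin n) F}
    (hA : SubpermanentsVanish k A) {R : Finset (Fin n)} (hR : R.card = k)
    (σ : Equiv.Perm (Fin n)) :
    (A.submatrix (fun r : R => (r : Fin n)) (fun r : R => σ r)).permanent = 0 :=
  hA.permanent_submatrix_eq_zero (by simpa using hR) Subtype.val_injective
    (σ.injective.comp Subtype.val_injective)

theorem SubpermanentsVanish.transpose {k : ℕ} {A : Matrix (Fin n) (Fin n) F}
    (hA : SubpermanentsVanish k A) : SubpermanentsVanish k Aᵀ := fun f g hf hg => by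
  rw [← permanent_transpose, transpose_submatrix, transpose_transpose]
  exact hA g f hg hf

theorem subpermanentsVanish_of_permanentalRank_eq {k : ℕ} {A : Matrix (Fin n) (Fin n) F}
    (hA : permanentalRank A = k) : SubpermanentsVanish (k + 1) A := fun f g hf hg => by
  by_contra h
  have := le_permanentalRank hf hg h
  simp [hA] at this

/-- The values of a permutation at two points can be prescribed. -/
theorem exists_perm_apply_eq {α : Type*} [DecidableEq α] {i i' j j' : α} (hi : i ≠ i')
    (hj : j ≠ j') : ∃ σ : Equiv.Perm α, σ i = j ∧ σ i' = j' := by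
  refine ⟨Equiv.swap (Equiv.swap i j i') j' * Equiv.swap i j, ?_, ?_⟩
  · rw [Equiv.Perm.mul_apply, Equiv.swap_apply_left]
    refine Equiv.swap_apply_of_ne_of_ne (fun h => hi ?_) hj
    have := congrArg (Equiv.swap i j) h
    simpa using this
  · rw [Equiv.Perm.mul_apply, Equiv.swap_apply_left]

end PermanentalRank

/-! ### Sets of cells meeting every transversal equally often -/

section Counting

open Finset

/-- A set of cells that is a union of `k` rows or a union of `k` columns. -/
def IsLineUnion {n : ℕ} (k : ℕ) (S : Set (Fin n × Fin n)) : Prop :=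
  (∃ I : Finset (Fin n), I.card = k ∧ S = {p | p.1 ∈ I}) ∨
    ∃ J : Finset (Fin n), J.card = k ∧ S = {p | p.2 ∈ J}

variable {n : ℕ}

/-- The `n` cyclic shifts of `σ` partition the grid into transversals, so their intersections with
`S` add up to `S.card`; an average of at least `k` makes every bound an equality. -/
theorem card_filter_perm_eq (hn : 0 < n) {k : ℕ} {S : Finset (Fin n × Fin n)}
    (hS : ∀ σ : Equiv.Perm (Fin n), (univ.filter fun i => (i, σ i) ∈ S).card ≤ k)
    (hcard : n * k ≤ S.card) (σ : Equiv.Perm (Fin n)) :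
    (univ.filter fun i => (i, σ i) ∈ S).card = k := by
  have : NeZero n := ⟨hn.ne'⟩
  have hsum : ∑ s : Fin n, (univ.filter fun i => (i, (Equiv.addRight s) (σ i)) ∈ S).card
      = S.card := by
    simp only [card_filter]
    rw [sum_comm]
    have : ∀ i, ∑ s : Fin n, (if (i, (Equiv.addRight s) (σ i)) ∈ S then 1 else 0)
        = ∑ j : Fin n, if (i, j) ∈ S then 1 else 0 := fun i =>
      Equiv.sum_comp (Equiv.addLeft (σ i)) fun j => if (i, j) ∈ S then 1 else 0
    rw [sum_congr rfl fun i _ => this i,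
      ← Fintype.sum_prod_type' fun i j => if (i, j) ∈ S then 1 else 0]
    simp
  have hle : ∀ s ∈ (univ : Finset (Fin n)),
      (univ.filter fun i => (i, (Equiv.addRight s) (σ i)) ∈ S).card ≤ k := fun s _ =>
    hS (σ.trans (Equiv.addRight s))
  have heq : ∑ s : Fin n, (univ.filter fun i => (i, (Equiv.addRight s) (σ i)) ∈ S).card
      = ∑ _s : Fin n, k := by
    refine le_antisymm (sum_le_sum hle) ?_
    rw [hsum]
    simpa using hcard
  have := (sum_eq_sum_iff_of_le hle).1 heq 0 (mem_univ _)
  simpa using this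

/-- A set of cells that meets the graphs of all permutations in the same number of cells
is a union of rows or a union of columns. -/
theorem isLineUnion_of_card_filter_perm_eq {k : ℕ} {S : Finset (Fin n × Fin n)}
    (hS : ∀ σ : Equiv.Perm (Fin n), (univ.filter fun i => (i, σ i) ∈ S).card = k) :
    IsLineUnion k (S : Set (Fin n × Fin n)) := by
  set x : Fin n → Fin n → ℕ := fun i j => if (i, j) ∈ S then 1 else 0 with hx
  have hone : ∀ i j, (i, j) ∈ S ↔ x i j = 1 := fun i j => by simp [hx]
  have hle : ∀ i j, x i j ≤ 1 := fun i j => by simp only [hx]; split_ifs <;> simp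
  have hdiag := hS 1
  simp only [Equiv.Perm.one_apply] at hdiag
  -- Composing a permutation with a transposition changes only two cells of its graph. The resulting
  -- identity makes the indicator a sum of a row function and a column function; being 0/1-valued,
  -- it depends on only one coordinate.
  have hswap : ∀ i i' j j', x i j + x i' j' = x i j' + x i' j := by
    intro i i' j j'
    by_cases hi : i = i'
    · subst hi; exact add_comm _ _
    by_cases hj : j = j'
    · subst hj; rfl
    obtain ⟨σ, h₁, h₂⟩ := exists_perm_apply_eq hi hj
    have key : ∑ r, x r (σ r) = ∑ r, x r ((σ * Equiv.swap i i') r) := by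
      have := (hS σ).trans (hS (σ * Equiv.swap i i')).symm
      simpa only [card_filter] using this
    have hi' : i' ∈ univ.erase i := by simp [Ne.symm hi]
    rw [← add_sum_erase _ _ (mem_univ i), ← add_sum_erase _ _ hi',
      ← add_sum_erase univ (fun r => x r ((σ * Equiv.swap i i') r)) (mem_univ i),
      ← add_sum_erase _ (fun r => x r ((σ * Equiv.swap i i') r)) hi'] at key
    have hrest : ∑ r ∈ (univ.erase i).erase i', x r ((σ * Equiv.swap i i') r)
        = ∑ r ∈ (univ.erase i).erase i', x r (σ r) := by
      refine sum_congr rfl fun r hr => ?_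
      simp only [mem_erase] at hr
      rw [Equiv.Perm.mul_apply, Equiv.swap_apply_of_ne_of_ne hr.2.1 hr.1]
    rw [hrest] at key
    simp only [Equiv.Perm.mul_apply, Equiv.swap_apply_left, Equiv.swap_apply_right, h₁, h₂] at key
    omega
  by_cases H : ∀ i j j', x i j = x i j'
  · left
    refine ⟨univ.filter fun i => (i, i) ∈ S, hdiag, ?_⟩
    ext ⟨i, j⟩
    simp [hone, H i j i]
  · right
    push Not at H
    obtain ⟨i, j, j', hne⟩ := H
    refine ⟨univ.filter fun i => (i, i) ∈ S, hdiag, ?_⟩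
    ext ⟨a, b⟩
    simp only [mem_coe, Set.mem_ofPred_eq, mem_filter, mem_univ, true_and, hone]
    have e₁ := hswap i a j j'
    have e₂ := hswap i b j j'
    have e₃ := hswap a b j b
    have := hle i j
    have := hle i j'
    have := hle a j
    have := hle a j'
    have := hle b j
    have := hle b j'
    omega

end Counting

/-! ### Leading positions of a space of matrices -/

section Pivots

open Finset Matrix Polynomial

variable {F : Type*} [Field F] {n : ℕ}

/-- The matrices whose entries outside of `S` are zero. -/
def supportedOn (F : Type*) [Field F] {n : ℕ} (S : Set (Fin n × Fin n)) :
    Submodule F (Matrix (Fin n) (Fin n) F) where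
  carrier := {A | ∀ i j, (i, j) ∉ S → A i j = 0}
  add_mem' hA hB i j h := by simp [hA i j h, hB i j h]
  zero_mem' _ _ _ := rfl
  smul_mem' c A hA i j h := by simp [hA i j h]

/-- The positions of the lexicographically first nonzero entries of the members of `V`. -/
def pivots (V : Submodule F (Matrix (Fin n) (Fin n) F)) : Set (Fin n × Fin n) :=
  {p | ∃ v ∈ V, v p.1 p.2 ≠ 0 ∧ (∀ i < p.1, ∀ j, v i j = 0) ∧ ∀ j < p.2, v p.1 j = 0}

theorem exists_mem_pivots {V : Submodule F (Matrix (Fin n) (Fin n) F)}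
    {v : Matrix (Fin n) (Fin n) F} (hv : v ∈ V) (h : v ≠ 0) :
    ∃ p ∈ pivots V, v p.1 p.2 ≠ 0 := by
  have h₁ : {i | ∃ j, v i j ≠ 0}.Nonempty := by
    by_contra hne
    refine h (Matrix.ext fun i j => ?_)
    by_contra hij
    exact hne ⟨i, j, hij⟩
  obtain ⟨i, hi, hmin⟩ := wellFounded_lt.has_min _ h₁
  obtain ⟨j, hj, hminj⟩ := wellFounded_lt.has_min {j | v i j ≠ 0} hi
  refine ⟨(i, j), ⟨v, hv, hj, fun a ha b => ?_, fun b hb => ?_⟩, hj⟩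
  · by_contra hab
    exact hmin a ⟨b, hab⟩ ha
  · by_contra hab
    exact hminj b hab hb

/-- The restriction of the members of `V` to the cells in `S`. -/
def restrictCells (V : Submodule F (Matrix (Fin n) (Fin n) F)) (S : Set (Fin n × Fin n)) :
    V →ₗ[F] (S → F) where
  toFun v p := (v : Matrix (Fin n) (Fin n) F) p.1.1 p.1.2
  map_add' _ _ := rfl
  map_smul' _ _ := rfl

theorem restrictCells_pivots_injective (V : Submodule F (Matrix (Fin n) (Fin n) F)) :
    Function.Injective (restrictCells V (pivots V)) := by
  rw [injective_iff_map_eq_zero]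
  intro v hv
  by_contra hne
  obtain ⟨p, hp, hvp⟩ := exists_mem_pivots v.2 fun h => hne (Subtype.ext h)
  exact hvp (congrFun hv ⟨p, hp⟩)

/-- Degeneration: in `∑ s ^ (n - t) • v t`, row `a` is divisible by `s ^ (n - a)`, because `v t`
vanishes above row `t`. After division, setting `s = 0` leaves row `a` of `v a`, whose entries left
of column `σ a` vanish. That matrix is triangular in the column order, so its permanent is a product
of leading entries. A nonzero polynomial over an infinite field then provides a usable `s`. -/
theorem exists_permanent_ne_zero_of_mem_pivots [Infinite F]
    {V : Submodule F (Matrix (Fin n) (Fin n) F)} (R : Finset (Fin n)) (σ : Equiv.Perm (Fin n))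
    (h : ∀ i ∈ R, (i, σ i) ∈ pivots V) :
    ∃ A ∈ V, (A.submatrix (fun r : R => (r : Fin n)) (fun r : R => σ r)).permanent ≠ 0 := by
  choose v hv hne hrow hcol using fun i : R => h i i.2
  simp only at hne hrow hcol
  let M : Matrix R R F[X] := Matrix.of fun a b =>
    ∑ t : R, X ^ ((a : ℕ) - (t : ℕ)) * C (v t a (σ b))
  have heval : ∀ s : F, M.permanent.eval s
      = (Matrix.of fun a b : R => ∑ t : R, s ^ ((a : ℕ) - (t : ℕ)) * v t a (σ b)).permanent := by
    intro s
    simp only [M, Matrix.permanent, eval_finsetSum, eval_prod, of_apply, eval_mul, eval_pow, eval_X,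
      eval_C]
  have h₀ : M.permanent.eval 0 ≠ 0 := by
    -- For `t > a` the truncated exponent is `0`, so that term vanishes through `v t` rather than
    -- through the power.
    have hent : ∀ a b : R, ∑ t : R, (0 : F) ^ ((a : ℕ) - (t : ℕ)) * v t a (σ b) = v a a (σ b) := by
      intro a b
      rw [sum_eq_single a]
      · simp
      · intro t _ hta
        rcases lt_trichotomy (t : Fin n) a with hlt | heq | hgt
        · have := Fin.lt_def.1 hlt
          rw [zero_pow (by omega), zero_mul]
        · exact absurd (Subtype.ext heq) hta
        · rw [hrow t a hgt, mul_zero]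
      · simp
    rw [heval, permanent_eq_prod_of_monotone_support (g := fun r : R => σ r)
      (σ.injective.comp Subtype.val_injective)]
    · refine prod_ne_zero_iff.2 fun a _ => ?_
      rw [of_apply, hent]
      exact hne a
    · intro a b hab
      rw [of_apply, hent]
      exact hcol a _ hab
  -- The factor `X` secures `s ≠ 0`, needed to undo the division of the rows.
  have hXM : (X * M.permanent : F[X]) ≠ 0 := by
    refine mul_ne_zero X_ne_zero fun h0 => h₀ (by rw [h0, eval_zero])
  obtain ⟨s, hs⟩ : ∃ s : F, (X * M.permanent).eval s ≠ 0 := by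
    by_contra! hall
    exact hXM (Polynomial.funext fun r => by rw [hall r, eval_zero])
  rw [eval_mul, eval_X, heval] at hs
  refine ⟨∑ t : R, s ^ (n - (t : ℕ)) • v t, V.sum_mem fun t _ => V.smul_mem _ (hv t), ?_⟩
  have hfac : (∑ t : R, s ^ (n - (t : ℕ)) • v t).submatrix (fun r : R => (r : Fin n))
      (fun r : R => σ r) = Matrix.of fun a b : R => s ^ (n - (a : ℕ)) *
        (Matrix.of fun a b : R => ∑ t : R, s ^ ((a : ℕ) - (t : ℕ)) * v t a (σ b)) a b * 1 := by
    ext a b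
    simp only [submatrix_apply, Matrix.sum_apply, Matrix.smul_apply, smul_eq_mul, of_apply, mul_sum,
      mul_one]
    refine sum_congr rfl fun t _ => ?_
    rcases lt_or_ge (a : Fin n) t with hlt | hge
    · rw [hrow t a hlt, mul_zero, mul_zero, mul_zero]
    · have := Fin.le_def.1 hge
      have := (a : Fin n).2
      rw [← mul_assoc, ← pow_add]
      congr 2
      omega
  rw [hfac, permanent_scale (fun a : R => s ^ (n - (a : ℕ))) (fun _ => 1)]
  simp only [prod_const_one, mul_one]
  exact mul_ne_zero (prod_ne_zero_iff.2 fun a _ => pow_ne_zero _ (left_ne_zero_of_mul hs))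
    (right_ne_zero_of_mul hs)

theorem isLineUnion_pivots [Infinite F] (hn : 0 < n) {k : ℕ}
    {V : Submodule F (Matrix (Fin n) (Fin n) F)} (hV : ∀ A ∈ V, SubpermanentsVanish (k + 1) A)
    (hdim : Module.finrank F V = n * k) : IsLineUnion k (pivots V) := by
  classical
  have hle := LinearMap.finrank_le_finrank_of_injective (restrictCells_pivots_injective V)
  rw [hdim, Module.finrank_fintype_fun_eq_card, ← Set.toFinset_card] at hle
  have key : ∀ σ : Equiv.Perm (Fin n),
      (univ.filter fun i => (i, σ i) ∈ (pivots V).toFinset).card ≤ k := by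
    intro σ
    by_contra! hlt
    obtain ⟨R, hR, hcard⟩ := exists_subset_card_eq (Nat.succ_le_of_lt hlt)
    obtain ⟨A, hA, hper⟩ := exists_permanent_ne_zero_of_mem_pivots (V := V) R σ fun i hi => by
      simpa using hR hi
    exact hper ((hV A hA).permanent_eq_zero hcard σ)
  have := isLineUnion_of_card_filter_perm_eq (card_filter_perm_eq hn key hle)
  rwa [Set.coe_toFinset] at this

end Pivots

/-! ### Spaces of dimension `n * k` with vanishing subpermanents -/

section SubspacesOfBoundedPermanentalRank

open Finset Matrix

variable {F : Type*} [Field F] {n : ℕ}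

theorem IsLineUnion.natCard_eq {k : ℕ} {S : Set (Fin n × Fin n)} (hS : IsLineUnion k S) :
    Nat.card S = n * k := by
  rcases hS with ⟨I, hI, rfl⟩ | ⟨I, hI, rfl⟩
  · have : {p : Fin n × Fin n | p.1 ∈ I} = (I ×ˢ univ : Finset (Fin n × Fin n)) := by
      ext p; simp
    rw [this, Nat.card_coe_set_eq, Set.ncard_coe_finset, card_product, hI, mul_comm]
    simp
  · have : {p : Fin n × Fin n | p.2 ∈ I} = (univ ×ˢ I : Finset (Fin n × Fin n)) := by
      ext p; simp
    rw [this, Nat.card_coe_set_eq, Set.ncard_coe_finset, card_product, hI]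
    simp

/-- The `e i c` are dual to the cells of the rows in `I`. Adjoining one row `l ∉ I` to well-chosen
combinations yields permanents of size `k + 1` whose vanishing kills every entry of `e i c` in row
`l`. -/
theorem single_mem_of_subpermanentsVanish (h2 : (2 : F) ≠ 0) (hn : 3 ≤ n) {k : ℕ}
    {V : Submodule F (Matrix (Fin n) (Fin n) F)} (hV : ∀ A ∈ V, SubpermanentsVanish (k + 1) A)
    {I : Finset (Fin n)} (hI : I.card = k) {e : Fin n → Fin n → Matrix (Fin n) (Fin n) F}
    (he : ∀ i ∈ I, ∀ c, e i c ∈ V)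
    (hentry : ∀ i ∈ I, ∀ c, ∀ r ∈ I, ∀ b, e i c r b = if i = r ∧ c = b then 1 else 0)
    {i : Fin n} (hi : i ∈ I) (c : Fin n) : single i c 1 ∈ V := by
  have hone : ∀ X ∈ V, ∀ l ∉ I, ∀ σ : Equiv.Perm (Fin n), (∀ r ∈ I, X r (σ r) ≠ 0) →
      (∀ r ∈ I, ∀ s, s ≠ r → X r (σ s) = 0) → X l (σ l) = 0 := by
    intro X hX l hl σ h₁ h₂
    have h := (hV X hX).permanent_eq_zero (R := insert l I) (by rw [card_insert_of_notMem hl, hI]) σ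
    rw [permanent_eq_prod_of_row (⟨l, mem_insert_self l I⟩ : (insert l I : Finset (Fin n)))] at h
    · obtain ⟨⟨r, hr⟩, -, h⟩ := prod_eq_zero_iff.1 h
      rcases mem_insert.1 hr with rfl | hr
      · exact h
      · exact absurd h (h₁ r hr)
    · rintro ⟨r, hr⟩ hrl ⟨s, hs⟩ hsr
      refine h₂ r ((mem_insert.1 hr).resolve_left fun h => hrl (Subtype.ext h)) s
        fun h => hsr (Subtype.ext h)
  have hsum : ∀ σ : Equiv.Perm (Fin n), ∀ r ∈ I, ∀ b,
      (∑ t ∈ I, e t (σ t)) r b = if σ r = b then 1 else 0 := by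
    intro σ r hr b
    rw [Matrix.sum_apply, sum_eq_single r]
    · simp [hentry r hr (σ r) r hr b]
    · intro t ht htr
      rw [hentry t ht _ r hr, if_neg fun h => htr h.1]
    · exact fun h => absurd hr h
  have hmem : ∀ σ : Equiv.Perm (Fin n), ∑ t ∈ I, e t (σ t) ∈ V := fun σ =>
    V.sum_mem fun t ht => he t ht _
  -- With `σ i = c` and `σ l = j`, adding `e i c` to the sum along `σ` only doubles the entry at
  -- `(i, c)`, still nonzero as `2 ≠ 0`. The entry at `(l, j)` vanishes before and after, hence so
  -- does that of `e i c`.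
  have hoff : ∀ i ∈ I, ∀ l ∉ I, ∀ c j, c ≠ j → e i c l j = 0 := by
    intro i hi l hl c j hcj
    obtain ⟨σ, hσi, hσl⟩ := exists_perm_apply_eq (show i ≠ l from fun h => hl (h ▸ hi)) hcj
    have e₁ := hone _ (hmem σ) l hl σ (fun r hr => by rw [hsum σ r hr]; simp)
      (fun r hr s hs => by
        rw [hsum σ r hr, if_neg fun h => hs (σ.injective h).symm])
    have e₂ := hone _ (V.add_mem (hmem σ) (he i hi c)) l hl σ
      (fun r hr => by
        rw [Matrix.add_apply, hsum σ r hr, hentry i hi c r hr, if_pos rfl]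
        split_ifs
        · rwa [one_add_one_eq_two]
        · simp)
      (fun r hr s hs => by
        rw [Matrix.add_apply, hsum σ r hr, hentry i hi c r hr,
          if_neg fun h => hs (σ.injective h).symm, if_neg, add_zero]
        rintro ⟨rfl, h⟩
        exact hs (σ.injective (hσi.trans h)).symm)
    rw [Matrix.add_apply, e₁, zero_add, hσl] at e₂
    exact e₂
  -- With `σ i = d` and `σ l = c`, row `i` has ones in both columns, so the permanent of the block
  -- on rows `i, l` is the sum of the entries of row `l` in columns `c` and `d`; `hoff` leaves one
  -- contribution to each.
  have hdiag : ∀ i ∈ I, ∀ l ∉ I, ∀ c d, c ≠ d → e i c l c + e i d l d = 0 := by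
    intro i hi l hl c d hcd
    have hil : i ≠ l := fun h => hl (h ▸ hi)
    obtain ⟨σ, hσi, hσl⟩ := exists_perm_apply_eq hil hcd.symm
    set X := ∑ t ∈ I, e t (σ t) + e i c with hXdef
    have hX : X ∈ V := V.add_mem (hmem σ) (he i hi c)
    have hXr : ∀ r ∈ I, ∀ b, X r b = (if σ r = b then 1 else 0) + if i = r ∧ c = b then 1 else 0 :=
      fun r hr b => by rw [hXdef, Matrix.add_apply, hsum σ r hr, hentry i hi c r hr]
    have h := (hV X hX).permanent_eq_zero (R := insert l I) (by rw [card_insert_of_notMem hl, hI]) σ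
    rw [permanent_eq_of_two_rows
      (p := (⟨i, mem_insert_of_mem hi⟩ : (insert l I : Finset (Fin n))))
      (q := ⟨l, mem_insert_self l I⟩) (fun h => hil (congrArg Subtype.val h))] at h
    · have hprod : ∏ r ∈ (univ.erase (⟨i, mem_insert_of_mem hi⟩ :
          (insert l I : Finset (Fin n)))).erase ⟨l, mem_insert_self l I⟩,
          (X.submatrix (fun r : (insert l I : Finset (Fin n)) => (r : Fin n))
            fun r : (insert l I : Finset (Fin n)) => σ r) r r ≠ 0 := by
        refine prod_ne_zero_iff.2 ?_
        rintro ⟨r, hr⟩ hr'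
        simp only [mem_erase, ne_eq, Subtype.mk.injEq, mem_univ, and_true] at hr'
        rw [submatrix_apply, hXr r ((mem_insert.1 hr).resolve_left hr'.1), if_pos rfl,
          if_neg fun h => hr'.2 h.1.symm]
        simp
      have h := (mul_eq_zero.1 h).resolve_right hprod
      simp only [submatrix_apply, hσi, hσl] at h
      rw [hXr i hi, hXr i hi, if_pos hσi, if_neg (fun h => hcd h.2),
        if_neg (fun h => hcd (h.symm.trans hσi)), if_pos ⟨rfl, rfl⟩] at h
      have hXc : X l c = e i c l c := by
        rw [hXdef, Matrix.add_apply, Matrix.sum_apply, sum_eq_zero, zero_add]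
        exact fun t ht => hoff t ht l hl _ _ fun h =>
          hl (σ.injective (h.trans hσl.symm) ▸ ht)
      have hXd : X l d = e i d l d := by
        rw [hXdef, Matrix.add_apply, Matrix.sum_apply, sum_eq_single i, hoff i hi l hl c d hcd,
          add_zero, hσi]
        · exact fun t ht hti => hoff t ht l hl _ _ fun h =>
            hti (σ.injective (h.trans hσi.symm))
        · exact fun h => absurd hi h
      rw [hXc, hXd] at h
      simpa using h
    · rintro ⟨r, hr⟩ hri hrl ⟨s, hs⟩ hsr
      rw [submatrix_apply, hXr r ((mem_insert.1 hr).resolve_left fun h => hrl (Subtype.ext h)),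
        if_neg fun h => hsr (Subtype.ext (σ.injective h).symm),
        if_neg fun h => hri (Subtype.ext h.1.symm), add_zero]
  have hzero : ∀ l ∉ I, ∀ j, e i c l j = 0 := by
    intro l hl j
    by_cases hcj : c = j
    · subst hcj
      -- Three distinct columns give three numbers with pairwise sums zero, so twice each is zero;
      -- this uses `n ≥ 3` and `2 ≠ 0`.
      obtain ⟨d, hd⟩ : ∃ d, d ∉ ({c} : Finset (Fin n)) := by
        by_contra! h
        have := card_le_card (fun x _ => h x : univ ⊆ ({c} : Finset (Fin n)))
        simp at this
        omega
      obtain ⟨d', hd'⟩ : ∃ d', d' ∉ ({c, d} : Finset (Fin n)) := by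
        by_contra! h
        have := (card_le_card (fun x _ => h x : univ ⊆ ({c, d} : Finset (Fin n)))).trans
          (card_le_two)
        simp at this
        omega
      simp only [mem_singleton, mem_insert, not_or] at hd hd'
      have e₁ := hdiag i hi l hl c d (Ne.symm hd)
      have e₂ := hdiag i hi l hl c d' (Ne.symm hd'.1)
      have e₃ := hdiag i hi l hl d d' (Ne.symm hd'.2)
      have : (2 : F) * e i c l c = 0 := by linear_combination e₁ + e₂ - e₃
      exact (mul_eq_zero.1 this).resolve_left h2
    · exact hoff i hi l hl c j hcj
  convert! he i hi c using 1
  ext r b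
  rw [single_apply]
  by_cases hr : r ∈ I
  · exact (hentry i hi c r hr b).symm
  · rw [hzero r hr, if_neg]
    rintro ⟨rfl, -⟩
    exact hr hi

theorem supportedOn_le_of_single_mem {S : Set (Fin n × Fin n)}
    {V : Submodule F (Matrix (Fin n) (Fin n) F)}
    (h : ∀ i j, (i, j) ∈ S → single i j 1 ∈ V) : supportedOn F S ≤ V := by
  intro A hA
  rw [matrix_eq_sum_single A]
  refine V.sum_mem fun i _ => V.sum_mem fun j _ => ?_
  by_cases hij : (i, j) ∈ S
  · have := V.smul_mem (A i j) (h i j hij)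
    rwa [smul_single, smul_eq_mul, mul_one] at this
  · rw [hA i j hij, single_zero]
    exact V.zero_mem

theorem eq_supportedOn_of_single_mem {S : Set (Fin n × Fin n)}
    {V : Submodule F (Matrix (Fin n) (Fin n) F)}
    (hinj : Function.Injective (restrictCells V S))
    (h : ∀ i j, (i, j) ∈ S → single i j 1 ∈ V) : V = supportedOn F S := by
  classical
  have hle := supportedOn_le_of_single_mem h
  refine le_antisymm (fun v hv => ?_) hle
  have hw : (Matrix.of fun i j => if (i, j) ∈ S then v i j else 0) ∈ supportedOn F S :=
    fun i j hij => by simp [hij]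
  have heq : (⟨v, hv⟩ : V) = ⟨_, hle hw⟩ := hinj (funext fun p => by
    change v p.1.1 p.1.2 = if (p.1.1, p.1.2) ∈ S then v p.1.1 p.1.2 else 0
    rw [if_pos p.2])
  exact Set.mem_of_eq_of_mem (s := (supportedOn F S : Set _)) (congrArg Subtype.val heq) hw

/-- A subspace of dimension `n * k` all of whose members have permanental rank at most `k` consists
of all matrices supported on some `k` rows or of all matrices supported on some `k` columns. -/
theorem exists_eq_supportedOn [Infinite F] (h2 : (2 : F) ≠ 0) (hn : 3 ≤ n) {k : ℕ}
    {V : Submodule F (Matrix (Fin n) (Fin n) F)} (hV : ∀ A ∈ V, SubpermanentsVanish (k + 1) A)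
    (hdim : Module.finrank F V = n * k) :
    ∃ S : Set (Fin n × Fin n), IsLineUnion k S ∧ V = supportedOn F S := by
  classical
  have hS := isLineUnion_pivots (by omega) hV hdim
  have hinj := restrictCells_pivots_injective V
  refine ⟨_, hS, eq_supportedOn_of_single_mem hinj ?_⟩
  -- The pivots number exactly `n * k`, so restriction to them is bijective and supplies the dual
  -- basis.
  have hsurj : Function.Surjective (restrictCells V (pivots V)) := by
    refine (LinearMap.injective_iff_surjective_of_finrank_eq_finrank ?_).1 hinj
    rw [hdim, Module.finrank_fintype_fun_eq_card, ← Nat.card_eq_fintype_card, hS.natCard_eq]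
  have hex : ∀ i c, ∃ v ∈ V, ∀ r b, (r, b) ∈ pivots V →
      v r b = if i = r ∧ c = b then 1 else 0 := by
    intro i c
    obtain ⟨v, hv⟩ := hsurj fun p => if i = p.1.1 ∧ c = p.1.2 then 1 else 0
    exact ⟨v, v.2, fun r b hrb => congrFun hv ⟨(r, b), hrb⟩⟩
  choose e he hentry using hex
  rcases hS with ⟨I, hI, hpiv⟩ | ⟨I, hI, hpiv⟩
  · rw [hpiv] at hentry ⊢
    intro i c hi
    exact single_mem_of_subpermanentsVanish h2 hn hV hI (fun i _ c => he i c)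
      (fun i _ c r hr b => hentry i c r b hr) hi c
  · rw [hpiv] at hentry ⊢
    intro c i hi
    have := single_mem_of_subpermanentsVanish h2 hn
      (V := V.comap (transposeLinearEquiv (Fin n) (Fin n) F F).toLinearMap)
      (fun A hA => by simpa using (hV Aᵀ hA).transpose) hI (e := fun i c => (e c i)ᵀ)
      (fun i _ c => by simpa using he c i)
      (fun i _ c r hr b => by
        rw [transpose_apply, hentry c i b r hr]
        simp only [and_comm]) hi c
    simpa using this

end SubspacesOfBoundedPermanentalRank

/-! ### Action of `T` on line spaces and matrix units -/

section Preservers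

open Finset Matrix Polynomial

variable {F : Type*} [Field F] {n k : ℕ}

theorem exists_polynomial_eval_eq_permanent {ι : Type*} [Fintype ι] [DecidableEq ι]
    (A B : Matrix ι ι F) : ∃ p : F[X], ∀ t, p.eval t = (A + t • B).permanent := by
  refine ⟨(Matrix.of fun i j => C (A i j) + X * C (B i j)).permanent, fun t => ?_⟩
  simp only [Matrix.permanent, eval_finsetSum, eval_prod, of_apply, eval_mul, eval_add, eval_X,
    eval_C, Matrix.add_apply, Matrix.smul_apply, smul_eq_mul]

/-- On the line from `A` to `B`, let `q` be a subpermanent of size `k` that is nonzero at `B`, and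
`p` the chosen subpermanent of the image. Where `q` is nonzero the rank is exactly `k`, so `p`
vanishes. Hence `p * q = 0`, so `p = 0`, in particular at `A`. -/
theorem subpermanentsVanish_map [Infinite F]
    {T : Matrix (Fin n) (Fin n) F →ₗ[F] Matrix (Fin n) (Fin n) F}
    (hT : ∀ A, permanentalRank A = k → permanentalRank (T A) = k)
    {W : Submodule F (Matrix (Fin n) (Fin n) F)} (hW : ∀ A ∈ W, permanentalRank A ≤ k)
    {B : Matrix (Fin n) (Fin n) F} (hB : B ∈ W) (hBk : permanentalRank B = k)
    {A : Matrix (Fin n) (Fin n) F} (hA : A ∈ W) : SubpermanentsVanish (k + 1) (T A) := by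
  intro f g hf hg
  obtain ⟨f', g', h'⟩ := (isGreatest_permanentalRank B).1
  obtain ⟨p, hp⟩ := exists_polynomial_eval_eq_permanent ((T A).submatrix f g)
    ((T B - T A).submatrix f g)
  obtain ⟨q, hq⟩ := exists_polynomial_eval_eq_permanent (A.submatrix f' g')
    ((B - A).submatrix f' g')
  have hq1 : q ≠ 0 := by
    rintro rfl
    have := hq 1
    rw [eval_zero, one_smul, submatrix_sub] at this
    exact h' (by simpa using this.symm)
  have hpq : p * q = 0 := by
    refine Polynomial.funext fun t => ?_
    rw [eval_mul, eval_zero]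
    by_cases ht : q.eval t = 0
    · rw [ht, mul_zero]
    · have hmem : A + t • (B - A) ∈ W := W.add_mem hA (W.smul_mem _ (W.sub_mem hB hA))
      have hge : k ≤ permanentalRank (A + t • (B - A)) := by
        have := le_permanentalRank (A := A + t • (B - A)) f'.injective g'.injective (by
          rwa [hq] at ht)
        simpa [hBk] using this
      have hv := subpermanentsVanish_of_permanentalRank_eq (hT _ (le_antisymm (hW _ hmem) hge))
        f g hf hg
      rw [map_add, map_smul, map_sub] at hv
      rw [hp]
      exact mul_eq_zero_of_left hv _
  have hp0 := hp 0
  rw [(mul_eq_zero.1 hpq).resolve_right hq1, eval_zero, zero_smul, add_zero] at hp0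
  exact hp0.symm

theorem finrank_supportedOn (S : Set (Fin n × Fin n)) :
    Module.finrank F (supportedOn F S) = Nat.card S := by
  classical
  have hb : Function.Bijective (restrictCells (supportedOn F S) S) := by
    constructor
    · rw [injective_iff_map_eq_zero]
      intro v hv
      ext i j
      by_cases hij : (i, j) ∈ S
      · exact congrFun hv ⟨(i, j), hij⟩
      · exact v.2 i j hij
    · intro x
      refine ⟨⟨Matrix.of fun i j => if h : (i, j) ∈ S then x ⟨(i, j), h⟩ else 0,
        fun i j hij => by simp [hij]⟩, funext fun p => ?_⟩
      change (if h : (p.1.1, p.1.2) ∈ S then x ⟨(p.1.1, p.1.2), h⟩ else 0) = x p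
      rw [dif_pos p.2]
  rw [(LinearEquiv.ofBijective _ hb).finrank_eq, Module.finrank_fintype_fun_eq_card,
    Nat.card_eq_fintype_card]

theorem sum_single_apply (R : Finset (Fin n)) (σ : Equiv.Perm (Fin n)) (a b : Fin n) :
    (∑ r ∈ R, single r (σ r) (1 : F)) a b = if a ∈ R ∧ σ a = b then 1 else 0 := by
  rw [Matrix.sum_apply]
  by_cases ha : a ∈ R
  · rw [sum_eq_single a]
    · simp [single_apply, ha]
    · intro r _ hr
      simp [hr]
    · exact fun h => absurd ha h
  · rw [sum_eq_zero]
    · simp [ha]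
    · intro r hr
      have : r ≠ a := fun h => ha (h ▸ hr)
      simp [this]

theorem permanentalRank_sum_single (R : Finset (Fin n)) (σ : Equiv.Perm (Fin n)) :
    permanentalRank (∑ r ∈ R, single r (σ r) (1 : F)) = R.card := by
  refine le_antisymm (permanentalRank_le_card fun i hi j => ?_)
    (card_le_permanentalRank_of_diagonal σ (fun r hr => ?_) fun r hr s hs hsr => ?_)
  · simp [sum_single_apply, hi]
  · simp [sum_single_apply, hr]
  · rw [sum_single_apply, if_neg]
    exact fun h => hsr (σ.injective h.2).symm

theorem exists_map_supportedOn_rows [Infinite F] (h2 : (2 : F) ≠ 0) (hn : 3 ≤ n)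
    {T : Matrix (Fin n) (Fin n) F →ₗ[F] Matrix (Fin n) (Fin n) F} (hinj : Function.Injective T)
    (hT : ∀ A, permanentalRank A = k → permanentalRank (T A) = k)
    (I : Finset (Fin n)) (hI : I.card = k) :
    ∃ S, IsLineUnion k S ∧ (supportedOn F {p | p.1 ∈ I}).map T = supportedOn F S := by
  refine exists_eq_supportedOn h2 hn ?_ ?_
  · rintro _ ⟨A, hA, rfl⟩
    refine subpermanentsVanish_map hT (W := supportedOn F {p | p.1 ∈ I})
      (fun A hA => hI ▸ permanentalRank_le_card fun i hi j => hA i j hi)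
      (B := ∑ r ∈ I, single r ((1 : Equiv.Perm (Fin n)) r) 1) ?_
      (by rw [permanentalRank_sum_single, hI]) hA
    intro i j hij
    rw [sum_single_apply, if_neg fun h => hij h.1]
  · rw [← (Submodule.equivMapOfInjective T hinj _).finrank_eq, finrank_supportedOn,
      IsLineUnion.natCard_eq (Or.inl ⟨I, hI, rfl⟩)]

theorem exists_map_supportedOn_cols [Infinite F] (h2 : (2 : F) ≠ 0) (hn : 3 ≤ n)
    {T : Matrix (Fin n) (Fin n) F →ₗ[F] Matrix (Fin n) (Fin n) F} (hinj : Function.Injective T)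
    (hT : ∀ A, permanentalRank A = k → permanentalRank (T A) = k)
    (J : Finset (Fin n)) (hJ : J.card = k) :
    ∃ S, IsLineUnion k S ∧ (supportedOn F {p | p.2 ∈ J}).map T = supportedOn F S := by
  set τ := transposeLinearEquiv (Fin n) (Fin n) F F
  obtain ⟨S, hS, h⟩ := exists_map_supportedOn_rows h2 hn (T := T ∘ₗ τ.toLinearMap)
    (hinj.comp τ.injective)
    (fun A hA => hT _ ((permanentalRank_transpose A).trans hA)) J hJ
  refine ⟨S, hS, ?_⟩
  rw [← h, Submodule.map_comp]
  congr 1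
  ext A
  refine ⟨fun hA => ⟨Aᵀ, fun i j hij => hA j i hij, transpose_transpose A⟩, ?_⟩
  rintro ⟨B, hB, rfl⟩
  exact fun i j hij => hB j i hij

theorem exists_map_single_eq [Infinite F] (h2 : (2 : F) ≠ 0) (hn : 3 ≤ n) (hk : 1 ≤ k)
    (hkn : k ≤ n - 1)
    {T : Matrix (Fin n) (Fin n) F →ₗ[F] Matrix (Fin n) (Fin n) F} (hbij : Function.Bijective T)
    (hT : ∀ A, permanentalRank A = k → permanentalRank (T A) = k) (p : Fin n × Fin n) :
    ∃ (q : Fin n × Fin n) (c : F), c ≠ 0 ∧ T (single p.1 p.2 1) = single q.1 q.2 c := by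
  obtain ⟨i, j⟩ := p
  have hne : T (single i j 1) ≠ 0 := fun h => by
    have h₀ := hbij.1 (h.trans (map_zero T).symm)
    have := congrFun (congrFun h₀ i) j
    simp at this
  obtain ⟨a, b, hab⟩ : ∃ a b, T (single i j 1) a b ≠ 0 := by
    by_contra! h
    exact hne (Matrix.ext h)
  obtain ⟨B, hB⟩ := hbij.2 (single a b 1)
  -- The image space consists of all matrices on `S'`, and `S'` contains `(a, b)`; so the preimage
  -- `B` of that unit lies in every line space through `(i, j)`.
  have key : ∀ S S' : Set (Fin n × Fin n), (supportedOn F S).map T = supportedOn F S' →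
      (i, j) ∈ S → B ∈ supportedOn F S := by
    intro S S' hSS hS
    have hmem : T (single i j 1) ∈ supportedOn F S' := by
      rw [← hSS]
      refine Submodule.mem_map_of_mem fun r s hrs => ?_
      rw [single_apply, if_neg]
      rintro ⟨rfl, rfl⟩
      exact hrs hS
    have hS' : (a, b) ∈ S' := by
      by_contra hn
      exact hab (hmem a b hn)
    have : single a b 1 ∈ (supportedOn F S).map T := by
      rw [hSS]
      intro r s hrs
      rw [single_apply, if_neg]
      rintro ⟨rfl, rfl⟩
      exact hrs hS'
    rw [← hB] at this
    obtain ⟨B', hB', heq⟩ := this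
    exact hbij.1 heq ▸ hB'
  -- Since `1 ≤ k ≤ n - 1`, a `k`-set of lines can contain one line and avoid another, so `B` is
  -- confined to the cell `(i, j)`.
  have hsep : ∀ x y : Fin n, y ≠ x → ∃ I : Finset (Fin n), I.card = k ∧ x ∈ I ∧ y ∉ I := by
    intro x y hxy
    obtain ⟨I, h₁, h₂, h₃⟩ := exists_subsuperset_card_eq (n := k)
      (show ({x} : Finset (Fin n)) ⊆ univ.erase y by simpa using hxy.symm) (by simpa using hk)
      (by simpa using hkn)
    exact ⟨I, h₃, h₁ (mem_singleton_self x), fun h => by simpa using h₂ h⟩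
  have hBs : B = B i j • single i j 1 := by
    ext r s
    rw [Matrix.smul_apply, single_apply]
    by_cases hr : r = i
    · by_cases hs : s = j
      · simp [hr, hs]
      · obtain ⟨J, hJ, h₁, h₂⟩ := hsep j s hs
        obtain ⟨S, -, hS⟩ := exists_map_supportedOn_cols h2 hn hbij.1 hT J hJ
        rw [key _ _ hS h₁ r s h₂]
        simp [Ne.symm hs]
    · obtain ⟨I, hI, h₁, h₂⟩ := hsep i r hr
      obtain ⟨S, -, hS⟩ := exists_map_supportedOn_rows h2 hn hbij.1 hT I hI
      rw [key _ _ hS h₁ r s h₂]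
      simp [Ne.symm hr]
  have hBij : B i j ≠ 0 := by
    intro h
    rw [hBs, h, zero_smul, map_zero] at hB
    have := congrFun (congrFun hB a) b
    simp at this
  rw [hBs, map_smul] at hB
  refine ⟨(a, b), (B i j)⁻¹, inv_ne_zero hBij, ?_⟩
  change T (single i j 1) = single a b (B i j)⁻¹
  rw [← mul_one (B i j)⁻¹, ← smul_eq_mul, ← smul_single, ← hB, smul_smul, inv_mul_cancel₀ hBij,
    one_smul]

/-- Two cells in a common row or column. -/
def SharesLine (p q : Fin n × Fin n) : Prop := p.1 = q.1 ∨ p.2 = q.2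

theorem sharesLine_map [Infinite F] (h2 : (2 : F) ≠ 0) (hn : 3 ≤ n) (hk : 1 ≤ k)
    (hkn : k ≤ n - 1)
    {T : Matrix (Fin n) (Fin n) F →ₗ[F] Matrix (Fin n) (Fin n) F} (hbij : Function.Bijective T)
    (hT : ∀ A, permanentalRank A = k → permanentalRank (T A) = k)
    {π : Fin n × Fin n → Fin n × Fin n} {c : Fin n × Fin n → F} (hc : ∀ p, c p ≠ 0)
    (hπ : Function.Injective π)
    (hTπ : ∀ p, T (single p.1 p.2 1) = single (π p).1 (π p).2 (c p))
    {p q : Fin n × Fin n} (hpq : SharesLine p q) : SharesLine (π p) (π q) := by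
  classical
  obtain rfl | hk2 : k = 1 ∨ 2 ≤ k := by omega
  · have key : ∀ S S' : Set (Fin n × Fin n), IsLineUnion 1 S' →
        (supportedOn F S).map T = supportedOn F S' → p ∈ S → q ∈ S → SharesLine (π p) (π q) := by
      intro S S' hS' hSS hp hq
      have hmem : ∀ p ∈ S, π p ∈ S' := by
        intro p hp
        have hmem : T (single p.1 p.2 1) ∈ supportedOn F S' := by
          rw [← hSS]
          refine Submodule.mem_map_of_mem fun r s hrs => ?_
          rw [single_apply, if_neg]
          rintro ⟨rfl, rfl⟩
          exact hrs hp
        by_contra hne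
        have := hmem _ _ hne
        rw [hTπ, single_apply_same] at this
        exact hc p this
      have hp' := hmem p hp
      have hq' := hmem q hq
      rcases hS' with ⟨I, hI, rfl⟩ | ⟨I, hI, rfl⟩
      · exact Or.inl (card_le_one.1 hI.le _ hp' _ hq')
      · exact Or.inr (card_le_one.1 hI.le _ hp' _ hq')
    rcases hpq with h | h
    · obtain ⟨S, hS, hSS⟩ := exists_map_supportedOn_rows h2 hn hbij.1 hT {p.1} (by simp)
      exact key _ _ hS hSS (by simp) (by simp [h])
    · obtain ⟨S, hS, hSS⟩ := exists_map_supportedOn_cols h2 hn hbij.1 hT {p.2} (by simp)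
      exact key _ _ hS hSS (by simp) (by simp [h])
  -- For `k ≥ 2`, two noncollinear cells extend to `k` cells of a transversal. The image has rank
  -- `k` but at most `k` nonzero cells, so these form a partial transversal and stay noncollinear.
  · have hnc : ∀ p q : Fin n × Fin n, ¬ SharesLine p q → ¬ SharesLine (π p) (π q) := by
      rintro ⟨i, j⟩ ⟨i', j'⟩ hpq
      simp only [SharesLine, not_or] at hpq ⊢
      obtain ⟨σ, h₁, h₂⟩ := exists_perm_apply_eq hpq.1 hpq.2
      obtain ⟨R, hsub, hR⟩ := exists_superset_card_eq (s := {i, i'}) (n := k)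
        (card_le_two.trans hk2) (by simp; omega)
      have hrk := hT _ ((permanentalRank_sum_single (F := F) R σ).trans hR)
      have hmax := (isGreatest_permanentalRank (T (∑ r ∈ R, single r (σ r) (1 : F)))).1
      rw [hrk] at hmax
      obtain ⟨f, g, hfg⟩ := hmax
      obtain ⟨τ, hτ⟩ := exists_ne_zero_of_permanent_ne_zero hfg
      have hex : ∀ a, ∃ r : R, π (r, σ r) = (f (τ a), g a) := by
        intro a
        by_contra! hne
        refine hτ a ?_
        rw [submatrix_apply, map_sum, Matrix.sum_apply]
        refine sum_eq_zero fun r hr => ?_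
        rw [hTπ (r, σ r), single_apply, if_neg]
        exact fun h => hne ⟨r, hr⟩ (Prod.ext h.1 h.2)
      choose ρ hρ using hex
      have hρi : Function.Injective ρ := by
        intro a b hab
        have := (hρ a).symm.trans ((congrArg (fun r : R => π (r, σ r)) hab).trans (hρ b))
        exact g.injective (congrArg Prod.snd this)
      have hρs := ((Fintype.bijective_iff_injective_and_card ρ).2 ⟨hρi, by simp [hR]⟩).2
      obtain ⟨a, ha⟩ := hρs ⟨i, hsub (by simp)⟩
      obtain ⟨b, hb⟩ := hρs ⟨i', hsub (by simp)⟩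
      have hab : a ≠ b := by
        rintro rfl
        exact hpq.1 (congrArg Subtype.val (ha.symm.trans hb))
      have e₁ := hρ a
      have e₂ := hρ b
      rw [ha] at e₁
      rw [hb] at e₂
      simp only [h₁, h₂] at e₁ e₂
      rw [e₁, e₂]
      exact ⟨fun h => hab (τ.injective (f.injective h)), fun h => hab (g.injective h)⟩
    by_contra hne
    -- An injective self-map of the finite set of noncollinear pairs is onto, so no collinear pair
    -- can be sent into it.
    set N : Finset ((Fin n × Fin n) × (Fin n × Fin n)) :=
      univ.filter fun x => ¬ SharesLine x.1 x.2 with hN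
    have himg : N.image (Prod.map π π) = N := by
      refine eq_of_subset_of_card_le (fun x hx => ?_)
        (card_image_of_injective _ (hπ.prodMap hπ)).ge
      obtain ⟨y, hy, rfl⟩ := mem_image.1 hx
      simp only [hN, mem_filter, mem_univ, true_and] at hy ⊢
      exact hnc _ _ hy
    have hmem : (π p, π q) ∈ N := by simpa [hN] using hne
    rw [← himg] at hmem
    obtain ⟨⟨p', q'⟩, hy, heq⟩ := mem_image.1 hmem
    simp only [Prod.map_apply, Prod.mk.injEq] at heq
    obtain rfl := hπ heq.1
    obtain rfl := hπ heq.2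
    simp only [hN, mem_filter, mem_univ, true_and] at hy
    exact hy hpq

end Preservers

/-! ### Maps of cells preserving collinearity -/

section RookGraph

variable {n : ℕ}

theorem fst_const_or_snd_const_of_sharesLine {ι : Type*} {f : ι → Fin n × Fin n}
    (hf : ∀ a b, SharesLine (f a) (f b)) :
    (∀ a b, (f a).1 = (f b).1) ∨ ∀ a b, (f a).2 = (f b).2 := by
  by_cases H : ∀ a b, (f a).1 = (f b).1
  · exact Or.inl H
  · right
    push Not at H
    obtain ⟨a, b, hab⟩ := H
    have h₂ : (f a).2 = (f b).2 := (hf a b).resolve_left hab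
    have key : ∀ x, (f x).2 = (f a).2 := by
      intro x
      rcases hf x a with h | h
      · rcases hf x b with h' | h'
        · exact absurd (h.symm.trans h') hab
        · exact h'.trans h₂.symm
      · exact h
    exact fun x y => (key x).trans (key y).symm

/-- Images of lines are full lines by injectivity. A row sent to a column would meet the image of
row `i₀`, which is a full row; so all rows go to rows, and then columns to columns. -/
theorem exists_perm_perm_of_fst_const (hn : 2 ≤ n) {π : Fin n × Fin n → Fin n × Fin n}
    (hπ : Function.Injective π) (hline : ∀ p q, SharesLine p q → SharesLine (π p) (π q))
    {i₀ : Fin n} (h₀ : ∀ j j', (π (i₀, j)).1 = (π (i₀, j')).1) :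
    ∃ α β : Equiv.Perm (Fin n), ∀ i j, π (i, j) = (α i, β j) := by
  let z : Fin n := ⟨0, by omega⟩
  let o : Fin n := ⟨1, by omega⟩
  have hzo : z ≠ o := fun h => by simpa [z, o] using congrArg Fin.val h
  have hsurj : ∀ i, (∀ j j', (π (i, j)).1 = (π (i, j')).1) → ∀ b, ∃ j, (π (i, j)).2 = b := by
    intro i hi
    refine Finite.injective_iff_surjective.1 fun j j' h => ?_
    exact congrArg Prod.snd (hπ (Prod.ext (hi j j') h))
  have hrow : ∀ i j j', (π (i, j)).1 = (π (i, j')).1 := by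
    intro i
    rcases fst_const_or_snd_const_of_sharesLine (f := fun j => π (i, j))
      (fun a b => hline _ _ (Or.inl rfl)) with h | h
    · exact h
    · exfalso
      have hfull : ∀ a, ∃ j, (π (i, j)).1 = a := by
        refine Finite.injective_iff_surjective.1 fun j j' h' => ?_
        exact congrArg Prod.snd (hπ (Prod.ext h' (h j j')))
      obtain ⟨j, hj⟩ := hfull (π (i₀, z)).1
      obtain ⟨j', hj'⟩ := hsurj i₀ h₀ (π (i, z)).2
      have heq : π (i, j) = π (i₀, j') :=
        Prod.ext (hj.trans (h₀ z j')) ((h j z).trans hj'.symm)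
      obtain rfl : i = i₀ := congrArg Prod.fst (hπ heq)
      have := hπ (Prod.ext (h₀ z o) (h z o) : π (i, z) = π (i, o))
      exact hzo (congrArg Prod.snd this)
  have hα : Function.Injective fun i => (π (i, z)).1 := by
    intro i i' h
    obtain ⟨j, hj⟩ := hsurj i' (hrow i') (π (i, z)).2
    have heq : π (i, z) = π (i', j) := Prod.ext (h.trans (hrow i' z j)) hj.symm
    exact congrArg Prod.fst (hπ heq)
  have hcol : ∀ j i i', (π (i, j)).2 = (π (i', j)).2 := by
    intro j
    rcases fst_const_or_snd_const_of_sharesLine (f := fun i => π (i, j))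
      (fun a b => hline _ _ (Or.inr rfl)) with h | h
    · exact absurd (hα ((hrow z z j).trans ((h z o).trans (hrow o j z)))) hzo
    · exact h
  have hβ : Function.Injective fun j => (π (z, j)).2 := by
    intro j j' h
    exact congrArg Prod.snd (hπ (Prod.ext (hrow z j j') h))
  refine ⟨Equiv.ofBijective _ (Finite.injective_iff_bijective.1 hα),
    Equiv.ofBijective _ (Finite.injective_iff_bijective.1 hβ), fun i j => ?_⟩
  exact Prod.ext (hrow i j z) (hcol j i z)

/-- The automorphisms of the rook's graph. -/
theorem exists_perm_perm_of_sharesLine (hn : 2 ≤ n) {π : Fin n × Fin n → Fin n × Fin n}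
    (hπ : Function.Injective π) (hline : ∀ p q, SharesLine p q → SharesLine (π p) (π q)) :
    (∃ α β : Equiv.Perm (Fin n), ∀ i j, π (i, j) = (α i, β j)) ∨
      ∃ α β : Equiv.Perm (Fin n), ∀ i j, π (i, j) = (β j, α i) := by
  rcases fst_const_or_snd_const_of_sharesLine (f := fun j => π ((⟨0, by omega⟩ : Fin n), j))
    (fun a b => hline _ _ (Or.inl rfl)) with h | h
  · exact Or.inl (exists_perm_perm_of_fst_const hn hπ hline h)
  · right
    obtain ⟨α, β, hαβ⟩ := exists_perm_perm_of_fst_const hn (π := Prod.swap ∘ π)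
      (Prod.swap_injective.comp hπ) (fun p q hpq => (hline p q hpq).symm) h
    exact ⟨α, β, fun i j => Prod.swap_injective (hαβ i j)⟩

end RookGraph

/-! ### Scalars of a monomial map -/

section MonomialMaps

open Finset Matrix

variable {F : Type*} [Field F] {n k : ℕ}

theorem permanentalRank_le_of_card_eq_succ {A : Matrix (Fin n) (Fin n) F} {R : Finset (Fin n)}
    (hR : R.card = k + 1) (σ : Equiv.Perm (Fin n)) (hrow : ∀ i, i ∉ R → ∀ j, A i j = 0)
    (hcol : ∀ i, i ∉ R → ∀ j, A j (σ i) = 0)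
    (hper : (A.submatrix (fun r : R => (r : Fin n)) (fun r : R => σ r)).permanent = 0) :
    permanentalRank A ≤ k := by
  refine permanentalRank_le fun r f g h => ?_
  by_contra! hlt
  have hle : r ≤ k + 1 := by
    have h₁ := le_permanentalRank f.injective g.injective h
    have h₂ := permanentalRank_le_card hrow
    simp only [Fintype.card_fin] at h₁
    omega
  obtain rfl : r = k + 1 := by omega
  have hf : univ.image f = R := by
    refine eq_of_subset_of_card_le (fun x hx => ?_) ?_
    · obtain ⟨a, -, rfl⟩ := mem_image.1 hx
      exact mem_of_permanent_ne_zero h hrow a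
    · rw [card_image_of_injective _ f.injective, hR]; simp
  have hg : univ.image g = R.image σ := by
    refine eq_of_subset_of_card_le (fun x hx => ?_) ?_
    · obtain ⟨a, -, rfl⟩ := mem_image.1 hx
      refine mem_of_permanent_ne_zero' h (fun j hj i => ?_) a
      have := hcol (σ.symm j) (fun hm => hj (mem_image.2 ⟨_, hm, by simp⟩)) i
      simpa using this
    · rw [card_image_of_injective _ g.injective, card_image_of_injective _ σ.injective, hR]; simp
  refine h ?_
  rw [← hper]
  refine permanent_submatrix_eq_of_range_eq A f.injective g.injective Subtype.val_injective
    (σ.injective.comp Subtype.val_injective) ?_ ?_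
  · ext x
    have := congrArg (x ∈ ·) hf
    simpa using this
  · ext x
    have := congrArg (x ∈ ·) hg
    simpa using this

/-- Scaling a 2 × 2 block of zero permanent, with entries `1, 1, -1, 1`, by `c` turns its permanent
into the minor of `c`. Completing the block by ones along `σ` to size `k + 1` gives rank `k`, so the
image permanent must vanish. -/
theorem mul_eq_mul_of_preserves_permanentalRank (hk : 1 ≤ k) (hkn : k ≤ n - 1)
    {T : Matrix (Fin n) (Fin n) F → Matrix (Fin n) (Fin n) F}
    (hT : ∀ A, permanentalRank A = k → permanentalRank (T A) = k)
    {α β : Equiv.Perm (Fin n)} {c : Fin n → Fin n → F} (hc : ∀ i j, c i j ≠ 0)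
    (hTc : ∀ A i j, T A (α i) (β j) = c i j * A i j) (i i' j j' : Fin n) :
    c i j * c i' j' = c i j' * c i' j := by
  by_cases hi : i = i'
  · subst hi; exact mul_comm _ _
  by_cases hj : j = j'
  · subst hj; rfl
  obtain ⟨σ, h₁, h₂⟩ := exists_perm_apply_eq hi hj
  obtain ⟨R, hsub, hR⟩ := exists_superset_card_eq (s := {i, i'}) (n := k + 1)
    (card_le_two.trans (by omega)) (by simp; omega)
  have hiR : i ∈ R := hsub (by simp)
  have hiR' : i' ∈ R := hsub (by simp)
  have hσ : ∀ a b, σ a = σ b ↔ a = b := fun a b => σ.injective.eq_iff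
  subst h₁ h₂
  set A : Matrix (Fin n) (Fin n) F := Matrix.of fun a b =>
    if a ∈ R then (if b = σ a then 1 else if a = i ∧ b = σ i' then 1 else
      if a = i' ∧ b = σ i then -1 else 0) else 0 with hA
  have hApply : ∀ r ∈ R, ∀ s, A r (σ s) = if s = r then 1 else if r = i ∧ s = i' then 1 else
      if r = i' ∧ s = i then -1 else 0 := by
    intro r hr s
    simp only [hA, of_apply, if_pos hr, hσ]
  have hne : (⟨i, hiR⟩ : R) ≠ ⟨i', hiR'⟩ := fun h => hi (congrArg Subtype.val h)
  have hrank : permanentalRank A = k := by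
    refine le_antisymm (permanentalRank_le_of_card_eq_succ hR σ (fun a ha b => ?_)
      (fun a ha b => ?_) ?_) ?_
    · simp [hA, ha]
    · by_cases hb : b ∈ R
      · have ha₁ : a ≠ b := fun h => ha (h ▸ hb)
        have ha₂ : a ≠ i := fun h => ha (h ▸ hiR)
        have ha₃ : a ≠ i' := fun h => ha (h ▸ hiR')
        simp [hApply b hb, ha₁, ha₂, ha₃]
      · simp [hA, hb]
    · rw [permanent_eq_of_two_rows hne]
      · simp only [submatrix_apply]
        rw [hApply i hiR, hApply i' hiR', hApply i hiR, hApply i' hiR']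
        simp [hi, Ne.symm hi]
      · rintro ⟨r, hr⟩ hri hri' ⟨s, hs⟩ hsr
        simp only [ne_eq, Subtype.mk.injEq] at hri hri' hsr
        simp only [submatrix_apply]
        rw [hApply r hr]
        simp [hri, hri', hsr]
    -- Dropping row `i'` and its column `σ i'` leaves an identity block of size `k`.
    · have hcard : (R.erase i').card = k := by rw [card_erase_of_mem hiR', hR]; rfl
      rw [← hcard]
      refine card_le_permanentalRank_of_diagonal σ (fun r hr => ?_) (fun r hr s hs hsr => ?_)
      · rw [hApply r (mem_of_mem_erase hr), if_pos rfl]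
        exact one_ne_zero
      · rw [hApply r (mem_of_mem_erase hr), if_neg hsr,
          if_neg (fun h => (ne_of_mem_erase hs) h.2), if_neg fun h => (ne_of_mem_erase hr) h.1]
  have hper := (subpermanentsVanish_of_permanentalRank_eq (hT A hrank)).permanent_submatrix_eq_zero
    (f := fun r : R => α r) (g := fun r : R => β (σ r)) (by simpa using hR)
    (α.injective.comp Subtype.val_injective)
    (β.injective.comp (σ.injective.comp Subtype.val_injective))
  rw [permanent_eq_of_two_rows hne] at hper
  · simp only [submatrix_apply, hTc] at hper
    rw [hApply i hiR, hApply i' hiR', hApply i hiR, hApply i' hiR'] at hper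
    have hprod := (mul_eq_zero.1 hper).resolve_right (prod_ne_zero_iff.2 fun r _ => by
      rw [hApply r r.2, if_pos rfl, mul_one]
      exact hc _ _)
    simp only [if_pos, hi, Ne.symm hi, and_self, if_false, false_and, and_false] at hprod
    linear_combination hprod
  · rintro ⟨r, hr⟩ hri hri' ⟨s, hs⟩ hsr
    simp only [ne_eq, Subtype.mk.injEq] at hri hri' hsr
    simp only [submatrix_apply, hTc]
    rw [hApply r hr]
    simp [hri, hri', hsr]

theorem apply_eq_of_map_single {T : Matrix (Fin n) (Fin n) F →ₗ[F] Matrix (Fin n) (Fin n) F}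
    {α β : Equiv.Perm (Fin n)} {c : Fin n → Fin n → F}
    (hTc : ∀ i j, T (single i j 1) = single (α i) (β j) (c i j)) (A : Matrix (Fin n) (Fin n) F)
    (i j : Fin n) : T A (α i) (β j) = c i j * A i j := by
  have hs : ∀ a b, T (single a b (A a b)) = single (α a) (β b) (c a b * A a b) := by
    intro a b
    rw [← mul_one (A a b), ← smul_eq_mul, ← smul_single, map_smul, hTc, smul_single]
    simp [mul_comm]
  conv_lhs => rw [matrix_eq_sum_single A]
  simp only [map_sum, hs, Matrix.sum_apply, single_apply, α.injective.eq_iff, β.injective.eq_iff]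
  rw [sum_eq_single i, sum_eq_single j]
  · simp
  · intro b _ hb
    simp [hb]
  · simp
  · intro a _ ha
    simp [ha]
  · simp

theorem mul_permutationMatrix_mul_apply {D₁ D₂ : Matrix (Fin n) (Fin n) F} (h₁ : D₁.IsDiag)
    (h₂ : D₂.IsDiag) (σ₁ σ₂ : Equiv.Perm (Fin n)) (A : Matrix (Fin n) (Fin n) F) (x y : Fin n) :
    (D₁ * permutationMatrix F σ₁ * A * permutationMatrix F σ₂ * D₂) x y
      = D₁ x x * A (σ₁⁻¹ x) (σ₂ y) * D₂ y y := by
  have hP₁ : ∀ B : Matrix (Fin n) (Fin n) F, ∀ x y,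
      (permutationMatrix F σ₁ * B) x y = B (σ₁⁻¹ x) y := by
    intro B x y
    simp [permutationMatrix, Matrix.mul_apply]
  have hP₂ : ∀ B : Matrix (Fin n) (Fin n) F, ∀ x y,
      (B * permutationMatrix F σ₂) x y = B x (σ₂ y) := by
    intro B x y
    have : ∀ z, y = σ₂⁻¹ z ↔ z = σ₂ y := fun z => by
      rw [Equiv.Perm.eq_inv_iff_eq, eq_comm]
    simp only [permutationMatrix, Matrix.mul_apply, of_apply, this]
    simp
  rw [← h₁.diagonal_diag, ← h₂.diagonal_diag, mul_diagonal, hP₂, Matrix.mul_assoc, diagonal_mul,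
    hP₁]
  simp

theorem exists_diag_of_map_single (hk : 1 ≤ k) (hkn : k ≤ n - 1)
    {T : Matrix (Fin n) (Fin n) F →ₗ[F] Matrix (Fin n) (Fin n) F}
    (hT : ∀ A, permanentalRank A = k → permanentalRank (T A) = k)
    {α β : Equiv.Perm (Fin n)} {c : Fin n → Fin n → F} (hc : ∀ i j, c i j ≠ 0)
    (hTc : ∀ i j, T (single i j 1) = single (α i) (β j) (c i j)) :
    ∃ (σ₁ σ₂ : Equiv.Perm (Fin n)) (D₁ D₂ : Matrix (Fin n) (Fin n) F),
      D₁.IsDiag ∧ D₂.IsDiag ∧ (∀ i, D₁ i i ≠ 0) ∧ (∀ i, D₂ i i ≠ 0) ∧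
      ∀ A, T A = D₁ * permutationMatrix F σ₁ * A * permutationMatrix F σ₂ * D₂ := by
  have happ := apply_eq_of_map_single hTc
  let z : Fin n := ⟨0, by omega⟩
  have hmul := mul_eq_mul_of_preserves_permanentalRank hk hkn hT hc happ
  -- The matrix `c` has rank one, so it is the product of its column `z` and its row `z`, divided by
  -- `c z z`.
  refine ⟨α, β⁻¹, diagonal fun x => c (α⁻¹ x) z, diagonal fun y => c z (β⁻¹ y) * (c z z)⁻¹,
    isDiag_diagonal _, isDiag_diagonal _, fun i => ?_, fun i => ?_, fun A => ?_⟩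
  · simpa using hc _ _
  · simpa using ⟨hc _ _, hc _ _⟩
  · ext x y
    rw [mul_permutationMatrix_mul_apply (isDiag_diagonal _) (isDiag_diagonal _),
      diagonal_apply_eq, diagonal_apply_eq]
    obtain ⟨i, rfl⟩ := α.surjective x
    obtain ⟨j, rfl⟩ := β.surjective y
    have hi : α⁻¹ (α i) = i := α.symm_apply_apply i
    have hj : β⁻¹ (β j) = j := β.symm_apply_apply j
    rw [happ, hi, hj]
    have := hmul i z j z
    have hz := hc z z
    field_simp
    linear_combination A i j * this

/-- No scalar need be nonzero: a nonzero subpermanent of `B` already forces the factors involved to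
be nonzero. -/
theorem permanentalRank_le_of_scale {A B : Matrix (Fin n) (Fin n) F} {d e : Fin n → F}
    {α β : Equiv.Perm (Fin n)} (h : ∀ i j, B i j = d i * A (α i) (β j) * e j) :
    permanentalRank B ≤ permanentalRank A := by
  refine permanentalRank_le fun r f g hfg => ?_
  have heq : B.submatrix f g = Matrix.of fun a b =>
      d (f a) * (A.submatrix (α ∘ f) (β ∘ g)) a b * e (g b) := by
    ext a b
    exact h _ _
  rw [heq, permanent_scale (fun a => d (f a)) (fun b => e (g b))] at hfg
  have := le_permanentalRank (α.injective.comp f.injective) (β.injective.comp g.injective)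
    (right_ne_zero_of_mul (left_ne_zero_of_mul hfg))
  simpa using this

theorem permanentalRank_mul_permutationMatrix_mul {D₁ D₂ : Matrix (Fin n) (Fin n) F}
    (h₁ : D₁.IsDiag) (h₂ : D₂.IsDiag) (hd₁ : ∀ i, D₁ i i ≠ 0) (hd₂ : ∀ i, D₂ i i ≠ 0)
    (σ₁ σ₂ : Equiv.Perm (Fin n)) (A : Matrix (Fin n) (Fin n) F) :
    permanentalRank (D₁ * permutationMatrix F σ₁ * A * permutationMatrix F σ₂ * D₂)
      = permanentalRank A := by
  refine le_antisymm (permanentalRank_le_of_scale (d := fun x => D₁ x x) (e := fun y => D₂ y y)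
      (mul_permutationMatrix_mul_apply h₁ h₂ σ₁ σ₂ A))
    (permanentalRank_le_of_scale (d := fun x => (D₁ (σ₁ x) (σ₁ x))⁻¹)
      (e := fun y => (D₂ (σ₂⁻¹ y) (σ₂⁻¹ y))⁻¹) (α := σ₁) (β := σ₂⁻¹) fun i j => ?_)
  rw [mul_permutationMatrix_mul_apply h₁ h₂]
  have := hd₁ (σ₁ i)
  have := hd₂ (σ₂⁻¹ j)
  have hi : σ₁⁻¹ (σ₁ i) = i := σ₁.symm_apply_apply i
  have hj : σ₂ (σ₂⁻¹ j) = j := σ₂.apply_symm_apply j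
  rw [hi, hj]
  field_simp

end MonomialMaps

/-! ### The characterization of the preservers -/

theorem theorem1p3 {F : Type*} [Field F] [Infinite F] (hF : ringChar F ≠ 2)
    {n k : ℕ} (hn : 3 ≤ n) (hk : 1 ≤ k) (hkn : k ≤ n - 1)
    (T : Matrix (Fin n) (Fin n) F →ₗ[F] Matrix (Fin n) (Fin n) F)
    (hT : Function.Bijective T) :
    T '' permanentalRankSet F n k ⊆ permanentalRankSet F n k ↔
      ∃ (σ₁ σ₂ : Equiv.Perm (Fin n)) (D₁ D₂ : Matrix (Fin n) (Fin n) F),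
        D₁.IsDiag ∧ D₂.IsDiag ∧ (∀ i, D₁ i i ≠ 0) ∧ (∀ i, D₂ i i ≠ 0) ∧
        ((∀ A : Matrix (Fin n) (Fin n) F,
            T A = D₁ * permutationMatrix F σ₁ * A * permutationMatrix F σ₂ * D₂) ∨
          (∀ A : Matrix (Fin n) (Fin n) F,
            T A = D₁ * permutationMatrix F σ₁ * A.transpose * permutationMatrix F σ₂ * D₂)) := by
  have h2 : (2 : F) ≠ 0 := Ring.two_ne_zero hF
  constructor
  · intro hsub
    have hpres : ∀ A, permanentalRank A = k → permanentalRank (T A) = k := fun A hA =>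
      hsub ⟨A, hA, rfl⟩
    choose π c hc hTπ using exists_map_single_eq h2 hn hk hkn hT hpres
    -- If two units had images at the same cell, these images would be proportional, contradicting
    -- injectivity of `T`.
    have hπ : Function.Injective π := by
      intro p q hpq
      have h₁ := hTπ p
      have h₂ := hTπ q
      rw [← hpq] at h₂
      have heq : T (c q • Matrix.single p.1 p.2 1) = T (c p • Matrix.single q.1 q.2 1) := by
        rw [map_smul, map_smul, h₁, h₂, Matrix.smul_single, Matrix.smul_single, smul_eq_mul,
          smul_eq_mul, mul_comm]
      have h₃ := congrFun (congrFun (hT.1 heq) p.1) p.2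
      rw [Matrix.smul_apply, Matrix.smul_apply, Matrix.single_apply_same, smul_eq_mul, mul_one,
        Matrix.single_apply] at h₃
      by_contra hne
      rw [if_neg fun h => hne (Prod.ext h.1.symm h.2.symm), smul_zero] at h₃
      exact hc q h₃
    rcases exists_perm_perm_of_sharesLine (by omega) hπ
      (fun p q => sharesLine_map h2 hn hk hkn hT hpres hc hπ hTπ) with
      ⟨α, β, hαβ⟩ | ⟨α, β, hαβ⟩
    · obtain ⟨σ₁, σ₂, D₁, D₂, h₁, h₂, h₃, h₄, h⟩ := exists_diag_of_map_single hk hkn hpres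
        (α := α) (β := β) (c := fun i j => c (i, j)) (fun i j => hc _)
        (fun i j => by simpa [hαβ] using hTπ (i, j))
      exact ⟨σ₁, σ₂, D₁, D₂, h₁, h₂, h₃, h₄, Or.inl h⟩
    · obtain ⟨σ₁, σ₂, D₁, D₂, h₁, h₂, h₃, h₄, h⟩ := exists_diag_of_map_single hk hkn
        (T := T ∘ₗ (Matrix.transposeLinearEquiv (Fin n) (Fin n) F F).toLinearMap)
        (fun A hA => hpres _ ((permanentalRank_transpose A).trans hA))
        (α := β) (β := α) (c := fun i j => c (j, i)) (fun i j => hc _)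
        (fun i j => by simpa [hαβ] using hTπ (j, i))
      exact ⟨σ₁, σ₂, D₁, D₂, h₁, h₂, h₃, h₄, Or.inr fun A => h A.transpose⟩
  · rintro ⟨σ₁, σ₂, D₁, D₂, h₁, h₂, h₃, h₄, h⟩ _ ⟨A, hA, rfl⟩
    change permanentalRank (T A) = k
    rcases h with h | h
    · rw [h, permanentalRank_mul_permutationMatrix_mul h₁ h₂ h₃ h₄]
      exact hA
    · rw [h, permanentalRank_mul_permutationMatrix_mul h₁ h₂ h₃ h₄, permanentalRank_transpose]
      exact hA
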